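/- Let $s\ge 2$ and $t$ be coprime natural numbers, and put $c=\tfrac12(s-1)(t-1)$ and $u=\lfloor s/2\rfloor$. A partition $\lambda=(\lambda_1\ge\lambda_2\ge\cdots)$ is an $s$-core if none of its hook lengths equals $s$, and is self-conjugate if its Young diagram is symmetric in the diagonal. A $t$-core of $\lambda$ is a $t$-core obtained from $\lambda$ by repeatedly removing rim hooks of length $t$. Let $W_s$ be the affine symmetric group, i.e. the group of permutations $w$ of $\mathbb Z$ with $w(m+s)=w(m)+s$ for all $m$ and $w(0)+\dots+w(s-1)=\binom s2$. It is generated by the elements $w_i$ ($i\in\mathbb Z/s\mathbb Z$), where $w_i(m)=m+1$ if $m\in i-1$, $w_i(m)=m-1$ if $m\in i$, and $w_i(m)=m$ otherwise. Let $H_s\le W_s$ be the affine hyperoctahedral group of degree $u$, generated by the elements $v_i$ ($i\in\mathbb Z/s\mathbb Z$), where $v_0=w_0$; $v_i=w_iw_{-i}w_i$ if $i$ is the class of $u$ or of $-u$; and $v_i=w_iw_{-i}$ otherwise. The level $t$ action $w\mapsto\bar w$ of $W_s$ on $\mathbb Z$ is the homomorphism determined by $\bar w_i(m)=m+t$ if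 $m\in(i-1)t-c$, $\bar w_i(m)=m-t$ if $m\in it-c$, and $\bar w_i(m)=m$ otherwise. The level $t$ action $w\mapsto\check w$ of $W_s$ on partitions is determined by $B(\check w\lambda)=\bar w\,B(\lambda)$, where $B(\lambda)=\{\lambda_r-r: r\ge1\}$. Then: 1. The level $t$ action of $H_s$ preserves the set of self-conjugate $s$-cores, and every self-conjugate $s$-core has a unique $t$-core. 2. Two self-conjugate $s$-cores have the same $t$-core if and only if they lie in the same orbit under the level $t$ action of $H_s$. 3. The $t$-core of a self-conjugate $s$-core $\lambda$ is again a self-conjugate $s$-core, and it lies in the same orbit as $\lambda$ under the level $t$ action of $H_s$. -/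

import Mathlib

namespace SCCore

/-! ### The affine symmetric group -/

/-- The displacement `w a - a` of `w`, where `a` is the representative of `i` in `[0, s)`.
For an `s`-periodic `w` any other representative gives the same value. -/
def disp (s : ℕ) (w : ℤ → ℤ) (i : ZMod s) : ℤ := w (i.val : ℤ) - (i.val : ℤ)

theorem periodic_mul {s : ℕ} {w : ℤ → ℤ} (hw : ∀ m, w (m + s) = w m + s) (m k : ℤ) :
    w (m + s * k) = w m + s * k := by
  induction k using Int.induction_on with
  | zero => simp
  | succ k ih =>
    have h := hw (m + s * k)
    rw [ih] at h
    rw [show m + (s : ℤ) * (k + 1) = m + s * k + s by ring, h]; ring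
  | pred k ih =>
    have h := hw (m + s * (-k - 1))
    rw [show m + (s : ℤ) * (-k - 1) + s = m + s * (-k) by ring, ih] at h
    linarith

theorem exists_mul_of_cast_eq {s : ℕ} {a b : ℤ} (h : (a : ZMod s) = b) : ∃ k : ℤ, a = b + s * k := by
  have := (ZMod.intCast_eq_intCast_iff_dvd_sub b a s).1 h.symm
  obtain ⟨k, hk⟩ := this
  exact ⟨k, by linarith⟩

theorem disp_cast {s : ℕ} [NeZero s] {w : ℤ → ℤ} (hw : ∀ m, w (m + s) = w m + s) (m : ℤ) :
    disp s w (m : ZMod s) = w m - m := by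
  obtain ⟨k, hk⟩ : ∃ k : ℤ, m = ((m : ZMod s).val : ℤ) + s * k := by
    apply exists_mul_of_cast_eq
    simp
  have h := periodic_mul hw ((m : ZMod s).val : ℤ) k
  rw [← hk] at h
  unfold disp
  rw [h]; linarith

/-- The map induced on residue classes modulo `s` by an `s`-periodic permutation is bijective. -/
theorem residue_bijective {s : ℕ} [NeZero s] (w : Equiv.Perm ℤ) (hw : ∀ m, w (m + s) = w m + s) :
    Function.Bijective (fun i : ZMod s => i + (disp s w i : ZMod s)) := by
  rw [← Finite.injective_iff_bijective]
  intro i j hij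
  have key : ∀ i : ZMod s, i + (disp s w i : ZMod s) = ((w (i.val : ℤ) : ℤ) : ZMod s) := by
    intro i; simp [disp]
  simp only [key] at hij
  obtain ⟨k, hk⟩ := exists_mul_of_cast_eq hij
  rw [← periodic_mul hw] at hk
  have := congrArg (fun z : ℤ => (z : ZMod s)) (w.injective hk)
  simpa using this

theorem sum_zmod {s : ℕ} [NeZero s] (f : ℕ → ℤ) :
    ∑ i : ZMod s, f i.val = ∑ m ∈ Finset.range s, f m := by
  refine Finset.sum_nbij' (fun i => i.val) (fun m => (m : ZMod s)) ?_ ?_ ?_ ?_ ?_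
  · intro i _; simpa using ZMod.val_lt i
  · intro m _; simp
  · intro i _; simp
  · intro m hm; exact ZMod.val_cast_of_lt (by simpa using hm)
  · intro i _; rfl

theorem sum_range_cast (s : ℕ) : ∑ m ∈ Finset.range s, (m : ℤ) = (s.choose 2 : ℕ) := by
  rw [Nat.choose_two_right, ← Finset.sum_range_id]; push_cast; rfl

theorem sum_disp {s : ℕ} [NeZero s] (w : ℤ → ℤ) :
    ∑ m ∈ Finset.range s, w m = (s.choose 2 : ℕ) ↔ ∑ i : ZMod s, disp s w i = 0 := by
  have : ∑ i : ZMod s, disp s w i = ∑ m ∈ Finset.range s, (w m - m) :=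
    sum_zmod (fun m => w m - m)
  rw [this, Finset.sum_sub_distrib, sum_range_cast, sub_eq_zero]

theorem disp_mul {s : ℕ} [NeZero s] {w v : ℤ → ℤ} (hw : ∀ m, w (m + s) = w m + s) (i : ZMod s) :
    disp s (fun m => w (v m)) i = disp s w (i + (disp s v i : ZMod s)) + disp s v i := by
  have : i + (disp s v i : ZMod s) = ((v (i.val : ℤ) : ℤ) : ZMod s) := by simp [disp]
  rw [this, disp_cast hw]
  simp only [disp]; ring

/-- The affine symmetric group of degree `s`: the permutations `w` of `ℤ` with
`w (m + s) = w m + s` for all `m` and `w 0 + ⋯ + w (s - 1) = s.choose 2`. -/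
def affineSymm (s : ℕ) [NeZero s] : Subgroup (Equiv.Perm ℤ) where
  carrier := {w | (∀ m, w (m + s) = w m + s) ∧
    ∑ m ∈ Finset.range s, w (m : ℤ) = (s.choose 2 : ℕ)}
  one_mem' := by
    refine ⟨fun m => rfl, ?_⟩
    simpa using sum_range_cast s
  mul_mem' := by
    rintro w v ⟨hw, hw'⟩ ⟨hv, hv'⟩
    refine ⟨fun m => by simp [hv, hw], ?_⟩
    rw [sum_disp] at *
    have h : ∀ i : ZMod s, disp s (w * v : Equiv.Perm ℤ) i
        = disp s w (i + (disp s v i : ZMod s)) + disp s v i := fun i => disp_mul hw i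
    simp only [h]
    rw [Finset.sum_add_distrib, hv', add_zero,
      (residue_bijective v hv).sum_comp (fun i => disp s w i), hw']
  inv_mem' := by
    rintro w ⟨hw, hw'⟩
    have hv : ∀ m, w⁻¹ (m + s) = w⁻¹ m + s := by
      intro m
      apply w.injective
      rw [hw]; simp
    refine ⟨hv, ?_⟩
    rw [sum_disp] at *
    have h : ∀ i : ZMod s, disp s (fun m => w ((w⁻¹ : Equiv.Perm ℤ) m)) i
        = disp s w (i + (disp s (w⁻¹ : Equiv.Perm ℤ) i : ZMod s)) + disp s (w⁻¹ : Equiv.Perm ℤ) i :=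
      fun i => disp_mul hw i
    have h0 : ∀ i : ZMod s, disp s (fun m => w ((w⁻¹ : Equiv.Perm ℤ) m)) i = 0 := fun i => by simp [disp]
    have h1 : ∑ i : ZMod s, (disp s w (i + (disp s (w⁻¹ : Equiv.Perm ℤ) i : ZMod s))
        + disp s (w⁻¹ : Equiv.Perm ℤ) i) = 0 :=
      Finset.sum_eq_zero fun i _ => by rw [← h, h0]
    rw [Finset.sum_add_distrib,
      (residue_bijective w⁻¹ hv).sum_comp (fun i => disp s w i), hw', zero_add] at h1
    exact h1

instance neZero_of_fact (s : ℕ) [h : Fact (1 < s)] : NeZero s := ⟨by have := h.out; omega⟩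

/-- The underlying function of the generator `w_i`, `i ∈ ℤ/sℤ`. -/
def genFun (s : ℕ) (i : ZMod s) (m : ℤ) : ℤ :=
  if (m : ZMod s) = i - 1 then m + 1 else if (m : ZMod s) = i then m - 1 else m

theorem genFun_involutive (s : ℕ) [Fact (1 < s)] (i : ZMod s) :
    Function.Involutive (genFun s i) := by
  intro m
  have h1 : i ≠ i - 1 := fun h => one_ne_zero (sub_eq_self.1 h.symm)
  unfold genFun
  by_cases h : (m : ZMod s) = i - 1
  · simp [h, h1]
  · by_cases h' : (m : ZMod s) = i
    · simp [h', h1]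
    · simp [h, h']

theorem genFun_sum (s : ℕ) [Fact (1 < s)] (i : ZMod s) : ∑ j : ZMod s, disp s (genFun s i) j = 0 := by
  have h1 : i ≠ i - 1 := fun h => one_ne_zero (sub_eq_self.1 h.symm)
  have h : ∀ j : ZMod s, disp s (genFun s i) j
      = (if j = i - 1 then 1 else 0) + (if j = i then -1 else 0) := by
    intro j
    have hc : (((j.val : ℕ) : ℤ) : ZMod s) = j := by simp
    unfold disp genFun
    rw [hc]
    by_cases h : j = i - 1
    · subst h; simp
    · by_cases h' : j = i
      · simp [h', h1]
      · simp [h, h']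
  simp [h, Finset.sum_add_distrib]

/-- The generator `w_i` of the affine symmetric group: it sends `m` to `m + 1` if `m ∈ i - 1`,
to `m - 1` if `m ∈ i`, and fixes all other `m`. -/
def gen (s : ℕ) [Fact (1 < s)] (i : ZMod s) : affineSymm s :=
  ⟨(genFun_involutive s i).toPerm, by
    refine ⟨fun m => ?_, (sum_disp (s := s) (genFun s i)).2 (genFun_sum s i)⟩
    simp only [Function.Involutive.coe_toPerm, genFun, Int.cast_add, Int.cast_natCast,
      ZMod.natCast_self, add_zero]
    split_ifs <;> ring⟩

/-! ### The affine hyperoctahedral group -/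

/-- The element `v_i`, where `u = ⌊s/2⌋`: `w_0` for `i = 0`, `w_i w_{-i} w_i` for `i = ±u`,
and `w_i w_{-i}` for the remaining `i`, that is for `i = ±l` with `1 ≤ l < u`. -/
def hypGen (s : ℕ) [Fact (1 < s)] (i : ZMod s) : affineSymm s :=
  if i = 0 then gen s i
  else if i = ((s / 2 : ℕ) : ZMod s) ∨ i = -((s / 2 : ℕ) : ZMod s) then
    gen s i * gen s (-i) * gen s i
  else gen s i * gen s (-i)

/-- The affine hyperoctahedral group, as the subgroup of the affine symmetric group of degree `s`
generated by the elements `v_i`. -/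
def hyp (s : ℕ) [Fact (1 < s)] : Subgroup (affineSymm s) :=
  Subgroup.closure (Set.range (hypGen s))

/-! ### The level `t` action on the integers -/

/-- `(s - 1)(t - 1) / 2`; the division is exact for coprime `s, t ≥ 1`. -/
def shift (s t : ℕ) : ℕ := (s - 1) * (t - 1) / 2

/-- `m ↦ m + t (w a - a)`, where `a t ≡ m + shift s t` modulo `s`. -/
def levelFun (s t : ℕ) (w : ℤ → ℤ) (m : ℤ) : ℤ :=
  m + t * disp s w ((t : ZMod s)⁻¹ * ((m : ZMod s) + (shift s t : ZMod s)))

theorem inv_mul_self {s t : ℕ} (hst : s.Coprime t) : (t : ZMod s)⁻¹ * (t : ZMod s) = 1 := by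
  rw [mul_comm]; exact ZMod.coe_mul_inv_eq_one t hst.symm

theorem levelFun_mul {s t : ℕ} [NeZero s] (hst : s.Coprime t) {w : ℤ → ℤ} (v : ℤ → ℤ)
    (hw : ∀ m, w (m + s) = w m + s) (m : ℤ) :
    levelFun s t (fun m => w (v m)) m = levelFun s t w (levelFun s t v m) := by
  have h := inv_mul_self hst
  simp only [levelFun]
  rw [disp_mul hw]
  set j := (t : ZMod s)⁻¹ * ((m : ZMod s) + (shift s t : ZMod s)) with hj
  have e : (t : ZMod s)⁻¹ * (((m + t * disp s v j : ℤ) : ZMod s) + (shift s t : ZMod s))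
      = j + (disp s v j : ZMod s) := by
    push_cast
    calc _ = j + ((t : ZMod s)⁻¹ * (t : ZMod s)) * (disp s v j : ZMod s) := by rw [hj]; ring
      _ = _ := by rw [h, one_mul]
  rw [e]; ring

/-- The level `t` action of the affine symmetric group on `ℤ`. It is the homomorphism whose values
at the generators `w_i` are given in `levelInt_gen`. -/
def levelInt (s t : ℕ) [NeZero s] (hst : s.Coprime t) : affineSymm s →* Equiv.Perm ℤ :=
  MonoidHom.toHomPerm
    { toFun := fun w => (levelFun s t w.1 : Function.End ℤ)
      map_one' := by
        funext m
        change levelFun s t (fun m => m) m = m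
        simp [levelFun, disp]
      map_mul' := by
        intro w v
        funext m
        exact levelFun_mul hst v.1 w.2.1 m }

theorem levelInt_apply {s t : ℕ} [NeZero s] (hst : s.Coprime t) (w : affineSymm s) (m : ℤ) :
    levelInt s t hst w m = levelFun s t w.1 m := rfl

/-- The defining formula of the level `t` action on generators: `w_i` sends `m` to `m + t` if
`m ∈ (i - 1) t - c`, to `m - t` if `m ∈ i t - c`, and fixes all other `m`, where
`c = (s - 1)(t - 1) / 2`. -/
theorem levelInt_gen (s t : ℕ) [Fact (1 < s)] (hst : s.Coprime t) (i : ZMod s) (m : ℤ) :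
    levelInt s t hst (gen s i) m =
      if (m : ZMod s) = (i - 1) * t - shift s t then m + t
      else if (m : ZMod s) = i * t - shift s t then m - t
      else m := by
  have h := inv_mul_self hst
  have e : ∀ x : ZMod s, (t : ZMod s)⁻¹ * ((m : ZMod s) + (shift s t : ZMod s)) = x ↔
      (m : ZMod s) = x * t - shift s t := by
    intro x
    constructor
    · rintro rfl
      linear_combination (-(m : ZMod s) - (shift s t : ZMod s)) * h
    · intro hx
      rw [hx]
      linear_combination x * h
  rw [levelInt_apply]
  simp only [levelFun, ← e]
  set j := (t : ZMod s)⁻¹ * ((m : ZMod s) + (shift s t : ZMod s))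
  have hc : (((j.val : ℕ) : ℤ) : ZMod s) = j := by simp
  have hd : disp s (gen s i).1 j = genFun s i (j.val : ℤ) - (j.val : ℤ) := rfl
  rw [hd, genFun, hc]
  split_ifs <;> ring

theorem levelInt_mem {s t : ℕ} [NeZero s] (hst : s.Coprime t) (w : affineSymm s) :
    levelInt s t hst w ∈ affineSymm s := by
  have hp : ∀ m, levelInt s t hst w (m + s) = levelInt s t hst w m + s := by
    intro m
    simp only [levelInt_apply, levelFun, Int.cast_add, Int.cast_natCast, ZMod.natCast_self,
      add_zero]
    ring
  refine ⟨hp, ?_⟩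
  rw [sum_disp]
  have hw := (sum_disp _).1 w.2.2
  have hb : Function.Bijective
      (fun i : ZMod s => (t : ZMod s)⁻¹ * (i + (shift s t : ZMod s))) := by
    rw [← Finite.injective_iff_bijective]
    intro i j hij
    have h := inv_mul_self hst
    simp only at hij
    linear_combination (t : ZMod s) * hij + (j - i) * h
  have : ∀ i : ZMod s, disp s (levelInt s t hst w) i
      = t * disp s w.1 ((t : ZMod s)⁻¹ * (i + (shift s t : ZMod s))) := by
    intro i
    have hc : (((i.val : ℕ) : ℤ) : ZMod s) = i := by simp
    rw [disp, levelInt_apply, levelFun, hc]; ring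
  simp only [this]
  rw [← Finset.mul_sum, hb.sum_comp (fun i => disp s w.1 i), hw, mul_zero]

/-! ### Partitions and beta-sets -/

/-- The beta-set `{λ_r - r : r ≥ 1}` of a partition (rows of a `YoungDiagram` are numbered
from `0`). -/
def betaSet (lam : YoungDiagram) : Set ℤ :=
  Set.range fun r : ℕ => (lam.rowLen r : ℤ) - (r + 1)

theorem betaSet_strictMono (lam : YoungDiagram) :
    StrictMono fun r : ℕ => ((r : ℤ) + 1 - lam.rowLen r) := by
  apply strictMono_nat_of_lt_succ
  intro r
  have := lam.rowLen_anti r (r + 1) (by omega)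
  push_cast
  omega

theorem betaSet_injective : Function.Injective betaSet := by
  intro lam mu h
  have h' : Set.range (fun r : ℕ => ((r : ℤ) + 1 - lam.rowLen r))
      = Set.range (fun r : ℕ => ((r : ℤ) + 1 - mu.rowLen r)) := by
    have e : ∀ nu : YoungDiagram, Set.range (fun r : ℕ => ((r : ℤ) + 1 - nu.rowLen r))
        = (fun z => -z) '' betaSet nu := by
      intro nu
      unfold betaSet
      rw [← Set.range_comp]
      congr 1
      funext r
      simp
    rw [e, e, h]
  have h2 := (StrictMono.range_inj (betaSet_strictMono lam) (betaSet_strictMono mu)).1 h'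
  apply YoungDiagram.ext
  ext ⟨r, c⟩
  have h3 : (r : ℤ) + 1 - lam.rowLen r = (r : ℤ) + 1 - mu.rowLen r := congrFun h2 r
  rw [YoungDiagram.mem_cells, YoungDiagram.mem_cells, YoungDiagram.mem_iff_lt_rowLen,
    YoungDiagram.mem_iff_lt_rowLen]
  omega

/-- `B` contains every integer below `-N` and exactly `N` other integers. This holds for some `N`
if and only if `B` is the beta-set of a partition. -/
def Charged (B : Set ℤ) (N : ℕ) : Prop :=
  (∀ m : ℤ, m < -N → m ∈ B) ∧ ∃ F : Finset ℤ, (∀ m, m ∈ F ↔ m ∈ B ∧ -(N : ℤ) ≤ m) ∧ F.card = N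

theorem Charged.mono {B : Set ℤ} {N M : ℕ} (h : Charged B N) (hNM : N ≤ M) : Charged B M := by
  obtain ⟨h1, F, h2, h3⟩ := h
  refine ⟨fun m hm => h1 m (by omega), F ∪ Finset.Ico (-(M : ℤ)) (-(N : ℤ)), ?_, ?_⟩
  · intro m
    rw [Finset.mem_union, h2, Finset.mem_Ico]
    constructor
    · rintro (⟨h, h'⟩ | ⟨h, h'⟩)
      · exact ⟨h, by omega⟩
      · exact ⟨h1 m h', h⟩
    · rintro ⟨h, h'⟩
      by_cases hm : m < -(N : ℤ)
      · exact Or.inr ⟨h', hm⟩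
      · exact Or.inl ⟨h, by omega⟩
  · rw [Finset.card_union_of_disjoint, h3, Int.card_Ico]
    · omega
    · rw [Finset.disjoint_left]
      intro m hm hm'
      have := (h2 m).1 hm
      rw [Finset.mem_Ico] at hm'
      omega

theorem charged_betaSet (lam : YoungDiagram) : Charged (betaSet lam) (lam.colLen 0) := by
  have h0 : ∀ r, lam.colLen 0 ≤ r → lam.rowLen r = 0 := by
    intro r hr
    by_contra h
    have : (r, 0) ∈ lam := YoungDiagram.mem_iff_lt_rowLen.2 (by omega)
    have := YoungDiagram.mem_iff_lt_colLen.1 this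
    omega
  refine ⟨?_, (Finset.range (lam.colLen 0)).image
    (fun r : ℕ => (lam.rowLen r : ℤ) - (r + 1)), ?_, ?_⟩
  · intro m hm
    refine ⟨(-m - 1).toNat, ?_⟩
    simp only
    rw [h0 _ (by omega)]
    omega
  · intro m
    simp only [Finset.mem_image, Finset.mem_range, betaSet, Set.mem_range]
    constructor
    · rintro ⟨r, hr, rfl⟩
      exact ⟨⟨r, rfl⟩, by omega⟩
    · rintro ⟨⟨r, rfl⟩, h⟩
      refine ⟨r, ?_, rfl⟩
      by_contra hr
      rw [h0 r (by omega)] at h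
      omega
  · rw [Finset.card_image_of_injective, Finset.card_range]
    intro a b hab
    apply (betaSet_strictMono lam).injective
    simp only at hab ⊢
    omega

/-- The partition with parts `f 0 ≥ f 1 ≥ ⋯`. -/
def ofParts (f : ℕ → ℕ) (hf : Antitone f) (N : ℕ) : YoungDiagram where
  cells := (Finset.range N ×ˢ Finset.range (f 0)).filter fun x => x.2 < f x.1
  isLowerSet := by
    rintro ⟨a, b⟩ ⟨c, d⟩ ⟨h1, h2⟩ h
    simp only [Finset.coe_filter, Finset.mem_product, Finset.mem_range, Set.mem_ofPred_eq] at h h1 h2 ⊢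
    have := hf h1
    omega

theorem rowLen_ofParts (f : ℕ → ℕ) (hf : Antitone f) (N : ℕ) (hN : ∀ r, N ≤ r → f r = 0) (r : ℕ) :
    (ofParts f hf N).rowLen r = f r := by
  have key : ∀ c, c < (ofParts f hf N).rowLen r ↔ c < f r := by
    intro c
    rw [← YoungDiagram.mem_iff_lt_rowLen, ← YoungDiagram.mem_cells]
    simp only [ofParts, Finset.mem_filter, Finset.mem_product, Finset.mem_range]
    constructor
    · exact fun h => h.2
    · intro h
      refine ⟨⟨?_, lt_of_lt_of_le h (hf (Nat.zero_le r))⟩, h⟩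
      by_contra hr
      rw [hN r (by omega)] at h
      omega
  have h1 := key (f r)
  have h2 := key ((ofParts f hf N).rowLen r)
  omega

theorem exists_of_charged {B : Set ℤ} {N : ℕ} (h : Charged B N) :
    ∃ lam : YoungDiagram, betaSet lam = B := by
  obtain ⟨h1, F, h2, h3⟩ := h
  set e := F.orderEmbOfFin h3 with he
  have emem : ∀ i, e i ∈ B ∧ -(N : ℤ) ≤ e i := fun i => (h2 _).1 (F.orderEmbOfFin_mem h3 i)
  -- the element of `B` at position `r` in decreasing order
  let b : ℕ → ℤ := fun r => if h : r < N then e ⟨N - 1 - r, by omega⟩ else -r - 1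
  have hbstep : ∀ r, b (r + 1) < b r := by
    intro r
    simp only [b]
    by_cases hr : r + 1 < N
    · rw [dif_pos hr, dif_pos (by omega)]
      apply e.strictMono
      rw [Fin.lt_def]
      simp only
      omega
    · rw [dif_neg hr]
      by_cases hr' : r < N
      · rw [dif_pos hr']
        have := (emem ⟨N - 1 - r, by omega⟩).2
        push_cast
        omega
      · rw [dif_neg hr']
        push_cast
        omega
  have htail : ∀ r, N ≤ r → b r = -r - 1 := fun r hr => by simp [b, not_lt.2 hr]
  have hanti : Antitone fun r : ℕ => b r + r + 1 := by
    apply antitone_nat_of_succ_le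
    intro r
    have := hbstep r
    push_cast
    omega
  have hnn : ∀ r : ℕ, 0 ≤ b r + r + 1 := by
    intro r
    have h := hanti (le_max_left r N)
    have h' := htail _ (le_max_right r N)
    simp only at h
    omega
  refine ⟨ofParts (fun r => (b r + r + 1).toNat)
    (fun i j hij => Int.toNat_le_toNat (hanti hij)) N, ?_⟩
  have hbeta : ∀ r : ℕ, ((b r + r + 1).toNat : ℤ) - (r + 1) = b r := by
    intro r
    have := hnn r
    omega
  unfold betaSet
  have hrow := rowLen_ofParts (fun r => (b r + r + 1).toNat)
    (fun i j hij => Int.toNat_le_toNat (hanti hij)) N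
    (fun r hr => by rw [htail r hr]; omega)
  simp only [hrow, hbeta]
  ext m
  constructor
  · rintro ⟨r, rfl⟩
    change b r ∈ B
    by_cases hr : r < N
    · simp only [b, dif_pos hr]
      exact (emem _).1
    · rw [htail r (by omega)]
      exact h1 _ (by omega)
  · intro hm
    by_cases hmN : m < -(N : ℤ)
    · refine ⟨(-m - 1).toNat, ?_⟩
      change b (-m - 1).toNat = m
      rw [htail _ (by omega)]
      omega
    · have hF : m ∈ (F : Set ℤ) := (h2 m).2 ⟨hm, by omega⟩
      rw [← F.range_orderEmbOfFin h3] at hF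
      obtain ⟨i, hi⟩ := hF
      have hi' := i.2
      refine ⟨N - 1 - i, ?_⟩
      simp only [b]
      rw [dif_pos (by omega)]
      rw [← hi]
      congr 1
      ext
      simp only
      omega

theorem sum_ediv {s : ℕ} [NeZero s] (x : affineSymm s) :
    ∑ r ∈ Finset.range s, x.1 (r : ℤ) / s = 0 := by
  have hs : (s : ℤ) ≠ 0 := by exact_mod_cast NeZero.ne s
  have h1 : ∑ r ∈ Finset.range s, x.1 (r : ℤ) % s = (s.choose 2 : ℕ) := by
    rw [← sum_zmod (fun r => x.1 (r : ℤ) % s), ← sum_range_cast, ← sum_zmod (fun r => (r : ℤ)),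
      ← (residue_bijective x.1 x.2.1).sum_comp (fun i : ZMod s => (i.val : ℤ))]
    refine Finset.sum_congr rfl fun i _ => ?_
    have : i + (disp s x.1 i : ZMod s) = ((x.1 (i.val : ℤ) : ℤ) : ZMod s) := by simp [disp]
    rw [this, ZMod.val_intCast]
  have h2 : ∑ r ∈ Finset.range s, x.1 (r : ℤ)
      = s * (∑ r ∈ Finset.range s, x.1 (r : ℤ) / s) + ∑ r ∈ Finset.range s, x.1 (r : ℤ) % s := by
    rw [Finset.mul_sum, ← Finset.sum_add_distrib]
    exact Finset.sum_congr rfl fun r _ => (Int.mul_ediv_add_emod _ _).symm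
  rw [h1, x.2.2] at h2
  have h3 : (s : ℤ) * (∑ r ∈ Finset.range s, x.1 (r : ℤ) / s) = 0 := by linarith
  exact (mul_eq_zero.1 h3).resolve_left hs

theorem exists_bound {s : ℕ} [NeZero s] (x : affineSymm s) :
    ∃ D : ℕ, ∀ m : ℤ, |x.1 m - m| ≤ D := by
  refine ⟨∑ i : ZMod s, (disp s x.1 i).natAbs, fun m => ?_⟩
  rw [← disp_cast x.2.1]
  have := Finset.single_le_sum (f := fun i : ZMod s => (disp s x.1 i).natAbs)
    (fun i _ => Nat.zero_le _) (Finset.mem_univ (m : ZMod s))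
  have h2 : (disp s x.1 (m : ZMod s)).natAbs ≤ ∑ i : ZMod s, (disp s x.1 i).natAbs := this
  rw [Int.abs_eq_natAbs]
  exact_mod_cast h2

theorem card_below {s : ℕ} [NeZero s] (x : affineSymm s) (D : ℕ) (hD : ∀ m : ℤ, |x.1 m - m| ≤ D) :
    ((Finset.Ico (0 : ℤ) (s * D + D)).filter fun b => x.1 b < s * D).card = s * D := by
  have hs : 0 < (s : ℤ) := by exact_mod_cast Nat.pos_of_ne_zero (NeZero.ne s)
  rw [Finset.card_eq_sum_card_fiberwise (f := fun b : ℤ => (b % s).toNat) (t := Finset.range s)]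
  · have hfib : ∀ r ∈ Finset.range s,
        (((Finset.Ico (0 : ℤ) (s * D + D)).filter fun b => x.1 b < s * D).filter
          fun b : ℤ => (b % s).toNat = r).card = (D - x.1 (r : ℤ) / s).toNat := by
      intro r hr
      have hr' : (r : ℤ) < s := by exact_mod_cast Finset.mem_range.1 hr
      have hlt : ∀ k : ℤ, x.1 (r + s * k) < s * D ↔ k < D - x.1 (r : ℤ) / s := by
        intro k
        rw [periodic_mul x.2.1, lt_sub_iff_add_lt, add_comm k, ← Int.add_mul_ediv_left _ _ hs.ne',
          Int.ediv_lt_iff_lt_mul hs, mul_comm (D : ℤ)]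
      have : ((Finset.Ico (0 : ℤ) (s * D + D)).filter fun b => x.1 b < s * D).filter
          (fun b : ℤ => (b % s).toNat = r)
          = (Finset.range (D - x.1 (r : ℤ) / s).toNat).image (fun k : ℕ => (r : ℤ) + s * k) := by
        ext b
        simp only [Finset.mem_filter, Finset.mem_Ico, Finset.mem_image, Finset.mem_range]
        constructor
        · rintro ⟨⟨⟨hb0, hb1⟩, hb2⟩, hb3⟩
          have hm := Int.emod_nonneg b hs.ne'
          have hd := Int.ediv_nonneg hb0 hs.le
          have hb := Int.mul_ediv_add_emod b s
          have hbr : b = r + s * ((b / s).toNat : ℕ) := by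
            rw [Int.toNat_of_nonneg hd]
            omega
          refine ⟨(b / s).toNat, ?_, hbr.symm⟩
          rw [hbr, hlt] at hb2
          omega
        · rintro ⟨k, hk, rfl⟩
          have hk' : x.1 (r + s * (k : ℤ)) < s * D := (hlt k).2 (by omega)
          have := abs_le.1 (hD (r + s * (k : ℤ)))
          refine ⟨⟨⟨by positivity, by omega⟩, hk'⟩, ?_⟩
          rw [Int.add_mul_emod_self_left, Int.emod_eq_of_lt (by omega) hr']
          simp
      rw [this, Finset.card_image_of_injective, Finset.card_range]
      intro a b hab
      have hab' : (s : ℤ) * a = s * b := by simpa using hab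
      exact_mod_cast mul_left_cancel₀ hs.ne' hab'
    rw [Finset.sum_congr rfl hfib]
    have hnn : ∀ r ∈ Finset.range s, (((D - x.1 (r : ℤ) / s).toNat : ℕ) : ℤ)
        = D - x.1 (r : ℤ) / s := by
      intro r hr
      have hr' : (r : ℤ) < s := by exact_mod_cast Finset.mem_range.1 hr
      apply Int.toNat_of_nonneg
      have h1 := abs_le.1 (hD r)
      have h2 : x.1 (r : ℤ) / s < D + 1 := by
        rw [Int.ediv_lt_iff_lt_mul hs]
        nlinarith
      omega
    have : ((∑ r ∈ Finset.range s, (D - x.1 (r : ℤ) / s).toNat : ℕ) : ℤ) = (s * D : ℕ) := by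
      push_cast
      rw [Finset.sum_congr rfl hnn, Finset.sum_sub_distrib, sum_ediv]
      simp
    exact_mod_cast this
  · intro b _
    have hm := Int.emod_nonneg b hs.ne'
    have hl := Int.emod_lt_of_pos b hs
    simp only [Finset.coe_range, Set.mem_Iio]
    omega

theorem charged_image {s : ℕ} [NeZero s] (x : affineSymm s) {B : Set ℤ} {N : ℕ}
    (h : Charged B N) : ∃ P, Charged (x.1 '' B) P := by
  obtain ⟨D, hD⟩ := exists_bound x
  have hD' : ∀ m : ℤ, x.1 m - m ≤ D ∧ -(D : ℤ) ≤ x.1 m - m := fun m =>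
    ⟨(abs_le.1 (hD m)).2, (abs_le.1 (hD m)).1⟩
  have hs1 : 1 ≤ s := Nat.pos_of_ne_zero (NeZero.ne s)
  obtain ⟨P, hP1, hP2⟩ : ∃ P, N + D ≤ P ∧ P = s * (N + D) := ⟨s * (N + D), by nlinarith, rfl⟩
  obtain ⟨T, hT1, hT2⟩ : ∃ T, D ≤ T ∧ T = s * D := ⟨s * D, by nlinarith, rfl⟩
  have hcard := card_below x D hD
  have hTz : (T : ℤ) = s * D := by rw [hT2]; push_cast; rfl
  rw [← hTz, ← hT2] at hcard
  have hshift : ∀ b : ℤ, x.1 (b - (P + T : ℕ)) = x.1 b - (P + T : ℕ) := by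
    intro b
    have := periodic_mul x.2.1 b (-((N + D : ℕ) + (D : ℕ) : ℤ))
    have e : (s : ℤ) * (-((N + D : ℕ) + (D : ℕ) : ℤ)) = -(P + T : ℕ) := by
      rw [hP2, hT2]; push_cast; ring
    rw [e] at this
    exact this
  obtain ⟨F, hF1, hF2⟩ := (h.mono (show N ≤ P + T by omega)).2
  refine ⟨P, ?_, (F.filter fun b => -(P : ℤ) ≤ x.1 b).image x.1, ?_, ?_⟩
  · intro m hm
    refine ⟨x.1.symm m, h.1 _ ?_, by simp⟩
    have := hD' (x.1.symm m)
    rw [Equiv.apply_symm_apply] at this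
    omega
  · intro m
    simp only [Finset.mem_image, Finset.mem_filter, hF1, Set.mem_image]
    constructor
    · rintro ⟨b, ⟨⟨hb, _⟩, hb'⟩, rfl⟩
      exact ⟨⟨b, hb, rfl⟩, hb'⟩
    · rintro ⟨⟨b, hb, rfl⟩, hb'⟩
      have := hD' b
      exact ⟨b, ⟨⟨hb, by push_cast; omega⟩, hb'⟩, rfl⟩
  · rw [Finset.card_image_of_injective _ x.1.injective]
    have hsplit := Finset.card_filter_add_card_filter_not (s := F) (fun b => -(P : ℤ) ≤ x.1 b)
    have hneg : (F.filter fun b => ¬ -(P : ℤ) ≤ x.1 b)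
        = ((Finset.Ico (0 : ℤ) (T + D)).filter fun b => x.1 b < T).image
          (fun b : ℤ => b - (P + T : ℕ)) := by
      ext b
      simp only [Finset.mem_filter, Finset.mem_image, Finset.mem_Ico, hF1]
      constructor
      · rintro ⟨⟨_, hb1⟩, hb2⟩
        have e := hshift (b + (P + T : ℕ))
        rw [add_sub_cancel_right] at e
        have := hD' b
        refine ⟨b + (P + T : ℕ), ⟨⟨by omega, ?_⟩, ?_⟩, by ring⟩
        · push_cast at *; omega
        · push_cast at *; omega
      · rintro ⟨a, ⟨⟨ha0, ha1⟩, ha2⟩, rfl⟩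
        have := hD' (a - (P + T : ℕ))
        rw [hshift] at *
        push_cast at *
        exact ⟨⟨h.1 _ (by omega), by omega⟩, by omega⟩
    rw [hneg, Finset.card_image_of_injective _ (sub_left_injective), hcard, hF2] at hsplit
    omega

/-- The image of a beta-set under an element of the affine symmetric group is a beta-set. -/
theorem exists_betaSet_image {s : ℕ} [NeZero s] {x : Equiv.Perm ℤ} (hx : x ∈ affineSymm s)
    (lam : YoungDiagram) : ∃ mu : YoungDiagram, betaSet mu = x '' betaSet lam := by
  obtain ⟨P, hP⟩ := charged_image ⟨x, hx⟩ (charged_betaSet lam)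
  exact exists_of_charged hP

/-! ### The level `t` action on partitions -/

/-- The level `t` action of the affine symmetric group on partitions, determined by
`betaSet_levelPart`. -/
noncomputable def levelPart (s t : ℕ) [NeZero s] (hst : s.Coprime t) :
    affineSymm s →* Equiv.Perm YoungDiagram :=
  MonoidHom.toHomPerm
    { toFun := fun w => ((fun lam => Classical.choose
        (exists_betaSet_image (levelInt_mem hst w) lam)) : Function.End YoungDiagram)
      map_one' := by
        funext lam
        apply betaSet_injective
        refine (Classical.choose_spec (exists_betaSet_image (levelInt_mem hst 1) lam)).trans ?_
        rw [map_one]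
        exact Set.image_id _
      map_mul' := by
        intro w v
        funext lam
        apply betaSet_injective
        refine (Classical.choose_spec (exists_betaSet_image (levelInt_mem hst (w * v)) lam)).trans ?_
        refine Eq.trans ?_ (Classical.choose_spec (exists_betaSet_image (levelInt_mem hst w) _)).symm
        rw [Classical.choose_spec (exists_betaSet_image (levelInt_mem hst v) lam), map_mul,
          Set.image_image]
        rfl }

theorem betaSet_levelPart (s t : ℕ) [NeZero s] (hst : s.Coprime t) (w : affineSymm s)
    (lam : YoungDiagram) :
    betaSet (levelPart s t hst w lam) = levelInt s t hst w '' betaSet lam :=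
  Classical.choose_spec (exists_betaSet_image (levelInt_mem hst w) lam)

/-- The orbit of `lam` under the level `t` action of the affine hyperoctahedral group. -/
def hypOrbit (s t : ℕ) [Fact (1 < s)] (hst : s.Coprime t) (lam : YoungDiagram) :
    Set YoungDiagram :=
  {mu | ∃ v ∈ hyp s, levelPart s t hst v lam = mu}

/-! ### Rim hooks and cores -/

/-- The rim hook of `lam` at the cell `c`: all cells weakly below and weakly to the right of `c`
whose diagonal successor is not in `lam`. -/
def rimHook (lam : YoungDiagram) (c : ℕ × ℕ) : Finset (ℕ × ℕ) :=
  lam.cells.filter fun x => c.1 ≤ x.1 ∧ c.2 ≤ x.2 ∧ (x.1 + 1, x.2 + 1) ∉ lam.cells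

/-- The hook length of `lam` at the cell `c`: the size of the rim hook at `c`. -/
def hookLength (lam : YoungDiagram) (c : ℕ × ℕ) : ℕ := (rimHook lam c).card

/-- `lam` is an `s`-core: none of its hook lengths equals `s`. -/
def IsCore (s : ℕ) (lam : YoungDiagram) : Prop := ∀ c ∈ lam, hookLength lam c ≠ s

/-- `mu` is obtained from `lam` by removing a rim hook of length `t`. -/
def RemovesHook (t : ℕ) (lam mu : YoungDiagram) : Prop :=
  ∃ c ∈ lam, hookLength lam c = t ∧ mu.cells = lam.cells \ rimHook lam c

/-- `nu` is a `t`-core of `lam`: a `t`-core obtained from `lam` by repeatedly removing rim hooks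
of length `t`. -/
def IsCoreOf (t : ℕ) (nu lam : YoungDiagram) : Prop :=
  Relation.ReflTransGen (RemovesHook t) lam nu ∧ IsCore t nu

/-- The set of self-conjugate `s`-cores. -/
def scCores (s : ℕ) : Set YoungDiagram := {lam | lam.transpose = lam ∧ IsCore s lam}

end SCCore

/-!
The beta-set of a partition is the set of beads of an abacus: removing a rim hook of length `t`
moves one bead from `m` to `m - t`, and a `t`-core is a partition for which no such move is
possible. A `t`-core is therefore determined by its charges modulo `t`, that is, by its beta-set
up to moving finitely many beads along the runners of the `t`-abacus. Both the removal of rim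
hooks of length `t` and the level `t` action preserve these charges, so the `t`-core of a
partition is unique, and partitions in the same orbit have the same `t`-core.

Conversely, the level `t` action commutes with translation by `s`, hence preserves `s`-cores.
Conjugation of partitions is complementation of the beta-set followed by `m ↦ -1 - m`, and it
carries the action of `w_i` to the action of `w_{-i}`. By the Coxeter relations the generators
`v_i` are unchanged when `i` is replaced by `-i`, so `H_s` preserves self-conjugacy. An `s`-core
is given by the ends of the runners of its `s`-abacus, on which `w_i` acts as an affine reflection
that lowers the sum of the squares as soon as a bead of the runner `i` can be moved down by `t`.
If this is the case for a self-conjugate `s`-core, then by symmetry it is also the case for the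
runner `-i`, and `v_i` lowers the sum of the squares. By descent each orbit of self-conjugate
`s`-cores contains a `t`-core, and by its charges this is the `t`-core of every element of the
orbit.
-/

namespace SCCore

section BetaSet

variable (lam : YoungDiagram)

theorem lt_rowLen_iff_lt_colLen (r c : ℕ) : c < lam.rowLen r ↔ r < lam.colLen c := by
  rw [← YoungDiagram.mem_iff_lt_rowLen, YoungDiagram.mem_iff_lt_colLen]

theorem mem_betaSet_iff (m : ℤ) :
    m ∈ betaSet lam ↔ ∃ r : ℕ, (lam.rowLen r : ℤ) - (r + 1) = m := Iff.rfl

/-- The profile of a diagram is a lattice path whose vertical steps are the elements of the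
beta-set; its horizontal steps are indexed by the columns. -/
theorem notMem_betaSet_iff (n : ℤ) :
    n ∉ betaSet lam ↔ ∃ c : ℕ, (c : ℤ) - lam.colLen c = n := by
  constructor
  · intro hn
    have hex : ∃ r : ℕ, (lam.rowLen r : ℤ) - (r + 1) ≤ n :=
      ⟨lam.rowLen 0 + n.natAbs, by
        have := lam.rowLen_anti 0 (lam.rowLen 0 + n.natAbs) (Nat.zero_le _)
        omega⟩
    classical
    obtain ⟨r, hr, hmin⟩ : ∃ r : ℕ, (lam.rowLen r : ℤ) - (r + 1) ≤ n ∧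
        ∀ k < r, n < (lam.rowLen k : ℤ) - (k + 1) :=
      ⟨Nat.find hex, Nat.find_spec hex, fun k hk => not_le.1 (Nat.find_min hex hk)⟩
    have hne : (lam.rowLen r : ℤ) - (r + 1) ≠ n := fun h => hn ⟨r, h⟩
    obtain ⟨c, hc⟩ := Int.eq_ofNat_of_zero_le (a := n + r) (by omega)
    have hcol : lam.colLen c = r := eq_of_forall_lt_iff fun k => by
      rw [← lt_rowLen_iff_lt_colLen]
      constructor
      · intro hk
        by_contra hrk
        have := lam.rowLen_anti r k (not_lt.1 hrk)
        omega
      · intro hk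
        have h1 := hmin (r - 1) (by omega)
        have h2 := lam.rowLen_anti k (r - 1) (by omega)
        omega
    exact ⟨c, by omega⟩
  · rintro ⟨c, rfl⟩ hc
    obtain ⟨r, hr⟩ := (mem_betaSet_iff lam _).1 hc
    have := lt_rowLen_iff_lt_colLen lam r c
    omega

theorem lt_rowLen_of_mem_betaSet {m : ℤ} (hm : m ∈ betaSet lam) : m < lam.rowLen 0 := by
  obtain ⟨r, rfl⟩ := (mem_betaSet_iff lam m).1 hm
  have := lam.rowLen_anti 0 r (Nat.zero_le r)
  omega

theorem neg_colLen_le_of_notMem_betaSet {m : ℤ} (hm : m ∉ betaSet lam) : -lam.colLen 0 ≤ m := by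
  obtain ⟨c, rfl⟩ := (notMem_betaSet_iff lam m).1 hm
  have := lam.colLen_anti 0 c (Nat.zero_le c)
  omega

theorem mem_betaSet_transpose (m : ℤ) : m ∈ betaSet lam.transpose ↔ -1 - m ∉ betaSet lam := by
  rw [notMem_betaSet_iff, mem_betaSet_iff]
  simp only [YoungDiagram.rowLen_transpose]
  exact exists_congr fun c => ⟨fun h => by omega, fun h => by omega⟩

end BetaSet

section RimHook

variable {lam mu : YoungDiagram} {t r c : ℕ}

theorem mem_rimHook {i j : ℕ} :
    (i, j) ∈ rimHook lam (r, c) ↔ (i, j) ∈ lam ∧ r ≤ i ∧ c ≤ j ∧ (i + 1, j + 1) ∉ lam := by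
  simp [rimHook, YoungDiagram.mem_cells]

theorem exists_last_on_diagonal {i j : ℕ} (h : (i, j) ∈ lam) :
    ∃ k, (i + k, j + k) ∈ lam ∧ (i + k + 1, j + k + 1) ∉ lam := by
  by_contra! hk
  have hall : ∀ k, (i + k, j + k) ∈ lam := Nat.rec h hk
  have h1 := YoungDiagram.mem_iff_lt_rowLen.1 (hall (lam.rowLen 0))
  have h2 := lam.rowLen_anti 0 (i + lam.rowLen 0) (Nat.zero_le _)
  omega

theorem injOn_content_rimHook (lam : YoungDiagram) (r c : ℕ) :
    Set.InjOn (fun x : ℕ × ℕ => (x.2 : ℤ) - x.1) (rimHook lam (r, c)) := by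
  have fst_le : ∀ i j i' j' : ℕ, (i, j) ∈ rimHook lam (r, c) → (i', j') ∈ rimHook lam (r, c) →
      (j : ℤ) - i = j' - i' → i' ≤ i := by
    intro i j i' j' hx hy hxy
    by_contra hlt
    exact (mem_rimHook.1 hx).2.2.2 (lam.up_left_mem (by omega) (by omega) (mem_rimHook.1 hy).1)
  rintro ⟨i, j⟩ hx ⟨i', j'⟩ hy hxy
  have h1 := fst_le i j i' j' hx hy hxy
  have h2 := fst_le i' j' i j hy hx hxy.symm
  simp only at hxy
  ext <;> simp only <;> omega

theorem image_content_rimHook (h : (r, c) ∈ lam) :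
    (rimHook lam (r, c)).image (fun x : ℕ × ℕ => (x.2 : ℤ) - x.1) =
      Finset.Ioc ((c : ℤ) - lam.colLen c) ((lam.rowLen r : ℤ) - (r + 1)) := by
  have hr := YoungDiagram.mem_iff_lt_rowLen.1 h
  ext d
  simp only [Finset.mem_image, Finset.mem_Ioc, Prod.exists]
  constructor
  · rintro ⟨i, j, hx, rfl⟩
    obtain ⟨hx1, hx2, hx3, -⟩ := mem_rimHook.1 hx
    have h1 := YoungDiagram.mem_iff_lt_rowLen.1 (lam.up_left_mem hx2 le_rfl hx1)
    have h2 := YoungDiagram.mem_iff_lt_colLen.1 (lam.up_left_mem le_rfl hx3 hx1)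
    omega
  · rintro ⟨hd1, hd2⟩
    obtain ⟨i, j, hij, hi, hj, hd⟩ :
        ∃ i j : ℕ, (i, j) ∈ lam ∧ r ≤ i ∧ c ≤ j ∧ (j : ℤ) - i = d := by
      by_cases hdc : (c : ℤ) ≤ r + d
      · exact ⟨r, (r + d).toNat, YoungDiagram.mem_iff_lt_rowLen.2 (by omega), le_rfl,
          by omega, by omega⟩
      · exact ⟨(c - d).toNat, c, YoungDiagram.mem_iff_lt_colLen.2 (by omega), by omega,
          le_rfl, by omega⟩
    obtain ⟨k, hk1, hk2⟩ := exists_last_on_diagonal hij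
    exact ⟨i + k, j + k, mem_rimHook.2 ⟨hk1, by omega, by omega, hk2⟩, by push_cast; omega⟩

theorem hookLength_eq (h : (r, c) ∈ lam) :
    (hookLength lam (r, c) : ℤ) = ((lam.rowLen r : ℤ) - (r + 1)) - (c - lam.colLen c) := by
  have hr := YoungDiagram.mem_iff_lt_rowLen.1 h
  have hc := YoungDiagram.mem_iff_lt_colLen.1 h
  rw [hookLength, ← Finset.card_image_of_injOn (injOn_content_rimHook lam r c),
    image_content_rimHook h, Int.card_Ioc]
  omega

theorem isCore_iff (ht : 0 < t) : IsCore t lam ↔ ∀ m ∈ betaSet lam, m - t ∈ betaSet lam := by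
  constructor
  · intro h m hm
    by_contra hn
    obtain ⟨r, hr⟩ := (mem_betaSet_iff lam m).1 hm
    obtain ⟨c, hc⟩ := (notMem_betaSet_iff lam _).1 hn
    have hrc : (r, c) ∈ lam := YoungDiagram.mem_iff_lt_rowLen.2 <| by
      have := lt_rowLen_iff_lt_colLen lam r c
      omega
    have := hookLength_eq hrc
    exact h _ hrc (by omega)
  · rintro h ⟨r, c⟩ hrc hl
    have := hookLength_eq hrc
    exact (notMem_betaSet_iff lam _).2 ⟨c, by omega⟩
      (h _ ((mem_betaSet_iff lam _).2 ⟨r, rfl⟩))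

/-- The diagram left after removing the rim hook at `c`. -/
def removeRimHook (lam : YoungDiagram) (c : ℕ × ℕ) : YoungDiagram where
  cells := lam.cells \ rimHook lam c
  isLowerSet := by
    rintro ⟨i, j⟩ ⟨i', j'⟩ ⟨h1, h2⟩ h
    obtain ⟨r, c⟩ := c
    simp only [Finset.coe_sdiff, Set.mem_sdiff, Finset.mem_coe, mem_rimHook,
      YoungDiagram.mem_cells] at h h1 h2 ⊢
    refine ⟨lam.up_left_mem h1 h2 h.1, fun hx => h.2 ⟨h.1, by omega, by omega, fun hy => ?_⟩⟩
    exact hx.2.2.2 (lam.up_left_mem (by omega) (by omega) hy)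

theorem card_cells_removeRimHook_lt {c : ℕ × ℕ} (hc : 0 < hookLength lam c) :
    (removeRimHook lam c).cells.card < lam.cells.card := by
  obtain ⟨x, hx⟩ := Finset.card_pos.1 hc
  exact Finset.card_lt_card <| Finset.ssubset_iff_subset_ne.2
    ⟨Finset.sdiff_subset, fun h => (Finset.mem_sdiff.1 (h.ge (Finset.mem_filter.1 hx).1)).2 hx⟩

theorem exists_isCoreOf (ht : 0 < t) (lam : YoungDiagram) : ∃ nu, IsCoreOf t nu lam := by
  induction hn : lam.cells.card using Nat.strong_induction_on generalizing lam with
  | _ n ih =>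
    by_cases h : IsCore t lam
    · exact ⟨lam, .refl, h⟩
    · simp only [IsCore, not_forall, not_not] at h
      obtain ⟨c, hc, hl⟩ := h
      obtain ⟨nu, hnu, hcore⟩ :=
        ih _ (hn ▸ card_cells_removeRimHook_lt (hl ▸ ht)) (removeRimHook lam c) rfl
      exact ⟨nu, .head ⟨c, hc, hl, rfl⟩ hnu, hcore⟩

theorem rowLen_of_cells_eq_sdiff (h : mu.cells = lam.cells \ rimHook lam (r, c)) (i : ℕ) :
    mu.rowLen i =
      if r ≤ i ∧ i < lam.colLen c then max c (lam.rowLen (i + 1) - 1) else lam.rowLen i := by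
  have lt_rowLen_iff : ∀ j, j < mu.rowLen i ↔
      j < lam.rowLen i ∧ ¬ (r ≤ i ∧ c ≤ j ∧ lam.rowLen (i + 1) ≤ j + 1) := by
    intro j
    rw [← YoungDiagram.mem_iff_lt_rowLen, ← YoungDiagram.mem_cells, h, Finset.mem_sdiff,
      mem_rimHook, YoungDiagram.mem_cells, YoungDiagram.mem_iff_lt_rowLen,
      YoungDiagram.mem_iff_lt_rowLen, not_lt]
    tauto
  have hanti := lam.rowLen_anti i (i + 1) (Nat.le_succ i)
  have hcol := lt_rowLen_iff_lt_colLen lam i c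
  refine eq_of_forall_lt_iff fun j => ?_
  rw [lt_rowLen_iff]
  split_ifs <;> omega

theorem betaSet_of_cells_eq_sdiff (hrc : (r, c) ∈ lam)
    (h : mu.cells = lam.cells \ rimHook lam (r, c)) :
    betaSet mu =
      insert ((c : ℤ) - lam.colLen c) (betaSet lam) \ {(lam.rowLen r : ℤ) - (r + 1)} := by
  have hrow := rowLen_of_cells_eq_sdiff h
  have hinj (i : ℕ) (hi : (lam.rowLen i : ℤ) - (i + 1) = (lam.rowLen r : ℤ) - (r + 1)) : i = r :=
    (betaSet_strictMono lam).injective (by linarith)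
  have hcol := fun i => lt_rowLen_iff_lt_colLen lam i c
  have hc := YoungDiagram.mem_iff_lt_rowLen.1 hrc
  have hr := YoungDiagram.mem_iff_lt_colLen.1 hrc
  ext m
  simp only [Set.mem_sdiff, Set.mem_insert_iff, Set.mem_singleton_iff, mem_betaSet_iff]
  constructor
  · rintro ⟨i, rfl⟩
    have hi := hcol (i + 1)
    rw [hrow]
    split_ifs with hin
    · rcases lt_or_ge (i + 1) (lam.colLen c) with hlt | hge
      · refine ⟨Or.inr ⟨i + 1, by push_cast; omega⟩, fun he => ?_⟩
        have := hinj (i + 1) (by push_cast; omega)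
        omega
      · exact ⟨Or.inl (by omega), by omega⟩
    · exact ⟨Or.inr ⟨i, rfl⟩, fun he => hin (by have := hinj i he; omega)⟩
  · rintro ⟨rfl | ⟨i, rfl⟩, hne⟩
    · have hi := hcol (lam.colLen c)
      refine ⟨lam.colLen c - 1, ?_⟩
      rw [hrow, Nat.sub_add_cancel (by omega), if_pos (by omega)]
      omega
    · have hi := hcol i
      by_cases hin : r < i ∧ i < lam.colLen c
      · refine ⟨i - 1, ?_⟩
        rw [hrow, Nat.sub_add_cancel (by omega), if_pos (by omega)]
        omega
      · have hir : i ≠ r := by rintro rfl; exact hne rfl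
        exact ⟨i, by rw [hrow, if_neg (by omega)]⟩

theorem RemovesHook.exists_betaSet_eq (h : RemovesHook t lam mu) :
    ∃ m ∈ betaSet lam, m - t ∉ betaSet lam ∧ betaSet mu = insert (m - t) (betaSet lam) \ {m} := by
  obtain ⟨⟨r, c⟩, hrc, rfl, hcells⟩ := h
  have hlen := hookLength_eq hrc
  have hend : (lam.rowLen r : ℤ) - (r + 1) - hookLength lam (r, c) = c - lam.colLen c := by omega
  exact ⟨_, ⟨r, rfl⟩, hend ▸ (notMem_betaSet_iff lam _).2 ⟨c, rfl⟩,
    hend ▸ betaSet_of_cells_eq_sdiff hrc hcells⟩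

end RimHook

section Charges

/-- The group of finitely supported permutations of `ℤ` that preserve residues modulo `t`. They
move finitely many beads along the runners of the `t`-abacus. -/
def runnerPerm (t : ℕ) : Subgroup (Equiv.Perm ℤ) where
  carrier := {f | {m | f m ≠ m}.Finite ∧ ∀ m, (f m : ZMod t) = m}
  one_mem' := ⟨by simp, fun _ => rfl⟩
  mul_mem' := by
    rintro f g ⟨hf, hf'⟩ ⟨hg, hg'⟩
    refine ⟨(hf.union hg).subset fun m hm => ?_, fun m => (hf' _).trans (hg' m)⟩
    by_contra hn
    simp only [Set.mem_union, Set.mem_ofPred_eq, not_or, not_not] at hn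
    exact hm (by rw [Equiv.Perm.mul_apply, hn.2, hn.1])
  inv_mem' := by
    rintro f ⟨hf, hf'⟩
    refine ⟨hf.subset fun m hm hfm => hm ?_, fun m => ?_⟩
    · rw [Equiv.Perm.inv_eq_iff_eq, hfm]
    · rw [← hf' (f⁻¹ m), Equiv.Perm.inv_def, Equiv.apply_symm_apply]

/-- Two sets of integers have the same charges modulo `t`: one is obtained from the other by moving
finitely many beads along the runners of the `t`-abacus. -/
def SameCharges (t : ℕ) (B C : Set ℤ) : Prop := ∃ f ∈ runnerPerm t, f '' B = C

variable {t : ℕ} {B C D : Set ℤ} {lam mu nu : YoungDiagram}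

theorem SameCharges.refl (t : ℕ) (B : Set ℤ) : SameCharges t B B :=
  ⟨1, one_mem _, Set.image_id B⟩

theorem SameCharges.symm (h : SameCharges t B C) : SameCharges t C B := by
  obtain ⟨f, hf, rfl⟩ := h
  exact ⟨f⁻¹, inv_mem hf, f.symm_image_image B⟩

theorem SameCharges.trans (h : SameCharges t B C) (h' : SameCharges t C D) : SameCharges t B D := by
  obtain ⟨f, hf, rfl⟩ := h
  obtain ⟨g, hg, rfl⟩ := h'
  exact ⟨g * f, mul_mem hg hf, Set.image_comp g f B⟩

theorem surjOn_of_finite_support {α : Type*} {f : Equiv.Perm α} (hf : {a | f a ≠ a}.Finite)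
    {S : Set α} (hS : Set.MapsTo f S S) : Set.SurjOn f S S := by
  have hmaps : Set.MapsTo f (S ∩ {a | f a ≠ a}) (S ∩ {a | f a ≠ a}) :=
    fun a ha => ⟨hS ha.1, fun h => ha.2 (f.injective h)⟩
  have hsurj := (((hf.inter_of_right S).injOn_iff_bijOn_of_mapsTo hmaps).1 f.injective.injOn).surjOn
  intro a ha
  by_cases hfa : f a = a
  · exact ⟨a, ha, hfa⟩
  · obtain ⟨b, hb, hba⟩ := hsurj ⟨ha, hfa⟩
    exact ⟨b, hb.1, hba⟩

theorem sub_mul_mem (hB : ∀ m ∈ B, m - t ∈ B) {m : ℤ} (hm : m ∈ B) (k : ℕ) : m - t * k ∈ B := by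
  induction k with
  | zero => simpa using hm
  | succ k ih =>
    have := hB _ ih
    rwa [show m - (t : ℤ) * (k + 1 : ℕ) = m - t * k - t by push_cast; ring]

theorem SameCharges.subset (h : SameCharges t B C) (hB : ∀ m ∈ B, m - t ∈ B)
    (hC : ∀ m ∈ C, m - t ∈ C) : B ⊆ C := by
  obtain ⟨f, ⟨hfin, hcast⟩, rfl⟩ := h
  intro m hm
  by_contra hmC
  -- Every bead of `f '' B` on the runner of the missing `m` lies below `m`, hence in `B`, so `f`
  -- maps the beads of `B` on this runner to each other; having finite support, it reaches `m`.
  have hmaps : Set.MapsTo f (B ∩ {b | (b : ZMod t) = m}) (B ∩ {b | (b : ZMod t) = m}) := by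
    rintro b ⟨hb, hbm⟩
    have hfb : (f b : ZMod t) = m := (hcast b).trans hbm
    refine ⟨?_, hfb⟩
    obtain ⟨k, hk⟩ := exists_mul_of_cast_eq hfb
    obtain ⟨k, rfl | rfl⟩ := k.eq_nat_or_neg
    · have := sub_mul_mem hC ⟨b, hb, rfl⟩ k
      exact absurd (by rwa [hk, add_sub_cancel_right] at this) hmC
    · rw [hk, mul_neg, ← sub_eq_add_neg]
      exact sub_mul_mem hB hm k
  obtain ⟨b, hb, hbm⟩ := surjOn_of_finite_support hfin hmaps ⟨hm, rfl⟩
  exact hmC ⟨b, hb.1, hbm⟩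

theorem RemovesHook.sameCharges (h : RemovesHook t lam mu) :
    SameCharges t (betaSet lam) (betaSet mu) := by
  obtain ⟨m, hm, hmt, hmu⟩ := h.exists_betaSet_eq
  refine ⟨Equiv.swap m (m - t), ⟨(Set.toFinite {m, m - (t : ℤ)}).subset fun x hx => ?_,
    fun x => ?_⟩, (Equiv.image_swap_of_mem_of_notMem hm hmt).trans hmu.symm⟩
  · by_contra hn
    simp only [Set.mem_insert_iff, Set.mem_singleton_iff, not_or] at hn
    exact hx (Equiv.swap_apply_of_ne_of_ne hn.1 hn.2)
  · rw [Equiv.swap_apply_def]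
    split_ifs <;> simp_all

theorem IsCoreOf.sameCharges (h : IsCoreOf t nu lam) :
    SameCharges t (betaSet lam) (betaSet nu) := by
  obtain ⟨h, -⟩ := h
  induction h with
  | refl => exact .refl _ _
  | tail _ h ih => exact ih.trans h.sameCharges

theorem IsCore.eq_of_sameCharges (ht : 0 < t) (hlam : IsCore t lam) (hmu : IsCore t mu)
    (h : SameCharges t (betaSet lam) (betaSet mu)) : lam = mu :=
  have hlam' := (isCore_iff ht).1 hlam
  have hmu' := (isCore_iff ht).1 hmu
  betaSet_injective ((h.subset hlam' hmu').antisymm (h.symm.subset hmu' hlam'))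

theorem isCoreOf_iff (ht : 0 < t) :
    IsCoreOf t nu lam ↔ IsCore t nu ∧ SameCharges t (betaSet lam) (betaSet nu) := by
  refine ⟨fun h => ⟨h.2, h.sameCharges⟩, fun ⟨hnu, hcharges⟩ => ?_⟩
  obtain ⟨mu, hmu⟩ := exists_isCoreOf ht lam
  rwa [← hmu.2.eq_of_sameCharges ht hnu (hmu.sameCharges.symm.trans hcharges)]

theorem existsUnique_isCoreOf (ht : 0 < t) (lam : YoungDiagram) : ∃! nu, IsCoreOf t nu lam := by
  obtain ⟨nu, hnu⟩ := exists_isCoreOf ht lam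
  exact ⟨nu, hnu, fun mu hmu =>
    hmu.2.eq_of_sameCharges ht hnu.2 (hmu.sameCharges.symm.trans hnu.sameCharges)⟩

/-- An involution that preserves residues moves infinitely many integers in general; undoing it
wherever it does not change membership in `B` makes it finitely supported. -/
theorem sameCharges_image_of_involutive {w : Equiv.Perm ℤ} (hw : Function.Involutive w)
    (hcast : ∀ m, (w m : ZMod t) = m) (hfin : {m | ¬(w m ∈ B ↔ m ∈ B)}.Finite) :
    SameCharges t B (w '' B) := by
  classical
  let f : ℤ → ℤ := fun m => if w m ∈ B ↔ m ∈ B then m else w m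
  have hf_mem : ∀ m, f m ∈ B ↔ w m ∈ B := fun m => by
    by_cases h : w m ∈ B ↔ m ∈ B <;> simp only [f, h, if_true, if_false]
  have hf : Function.Involutive f := fun m => by
    by_cases h : w m ∈ B ↔ m ∈ B
    · simp only [f, if_pos h]
    · have h' : ¬(w (w m) ∈ B ↔ w m ∈ B) := by rwa [hw m, iff_comm]
      simp only [f, if_neg h, if_neg h', hw m]
  refine ⟨hf.toPerm, ⟨hfin.subset fun m hm h => hm (if_pos h), fun m => ?_⟩, ?_⟩
  · change (f m : ZMod t) = m
    simp only [f]
    split_ifs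
    · rfl
    · exact hcast m
  · ext m
    rw [Function.Involutive.coe_toPerm, hf.image_eq_preimage_symm, hw.image_eq_preimage_symm]
    exact hf_mem m

theorem finite_setOf_not_iff_mem_betaSet {w : ℤ → ℤ} {D : ℕ} (hw : ∀ m, |w m - m| ≤ D)
    (lam : YoungDiagram) : {m | ¬(w m ∈ betaSet lam ↔ m ∈ betaSet lam)}.Finite := by
  refine (Set.finite_Icc (-(lam.colLen 0 + D : ℤ)) (lam.rowLen 0 + D)).subset fun m (hm : ¬_) => ?_
  have hwm := abs_le.1 (hw m)
  by_cases hm' : m ∈ betaSet lam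
  · have h1 := neg_colLen_le_of_notMem_betaSet lam (m := w m) (by tauto)
    have h2 := lt_rowLen_of_mem_betaSet lam hm'
    constructor <;> omega
  · have h1 := lt_rowLen_of_mem_betaSet lam (m := w m) (by tauto)
    have h2 := neg_colLen_le_of_notMem_betaSet lam hm'
    constructor <;> omega

end Charges

section Gen

variable {s t : ℕ} [Fact (1 < s)] (hst : s.Coprime t)

theorem gen_mul_self (i : ZMod s) : gen s i * gen s i = 1 := by
  apply Subtype.ext
  ext m
  exact genFun_involutive s i m

theorem levelInt_gen_involutive (i : ZMod s) :
    Function.Involutive (levelInt s t hst (gen s i)) := fun m => by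
  rw [← Equiv.Perm.mul_apply, ← map_mul, gen_mul_self, map_one, Equiv.Perm.one_apply]

theorem sameCharges_levelPart_gen (i : ZMod s) (lam : YoungDiagram) :
    SameCharges t (betaSet lam) (betaSet (levelPart s t hst (gen s i) lam)) := by
  obtain ⟨D, hD⟩ := exists_bound ⟨_, levelInt_mem hst (gen s i)⟩
  rw [betaSet_levelPart]
  refine sameCharges_image_of_involutive (levelInt_gen_involutive hst i) (fun m => ?_)
    (finite_setOf_not_iff_mem_betaSet hD lam)
  rw [levelInt_gen]
  split_ifs <;> simp

theorem hyp_le_closure_gen : hyp s ≤ Subgroup.closure (Set.range (gen s)) := by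
  have hgen (i : ZMod s) : gen s i ∈ Subgroup.closure (Set.range (gen s)) :=
    Subgroup.subset_closure ⟨i, rfl⟩
  rw [hyp, Subgroup.closure_le]
  rintro _ ⟨i, rfl⟩
  unfold hypGen
  split_ifs
  · exact hgen i
  · exact mul_mem (mul_mem (hgen i) (hgen (-i))) (hgen i)
  · exact mul_mem (hgen i) (hgen (-i))

theorem sameCharges_levelPart {w : affineSymm s} (hw : w ∈ Subgroup.closure (Set.range (gen s)))
    (lam : YoungDiagram) : SameCharges t (betaSet lam) (betaSet (levelPart s t hst w lam)) := by
  induction hw using Subgroup.closure_induction generalizing lam with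
  | mem x hx =>
    obtain ⟨i, rfl⟩ := hx
    exact sameCharges_levelPart_gen hst i lam
  | one => rw [map_one]; exact .refl _ _
  | mul x y _ _ hx hy =>
    rw [map_mul, Equiv.Perm.mul_apply]
    exact (hy lam).trans (hx _)
  | inv x _ hx =>
    simpa only [map_inv, Equiv.Perm.inv_def, Equiv.apply_symm_apply] using
      (hx (levelPart s t hst x⁻¹ lam)).symm

end Gen

section Coxeter

variable {s : ℕ} [Fact (1 < s)] {i j : ZMod s}

theorem gen_apply_cases (i : ZMod s) (m : ℤ) :
    ((m : ZMod s) = i - 1 ∧ (gen s i).1 m = m + 1 ∧ ((gen s i).1 m : ZMod s) = i) ∨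
    ((m : ZMod s) = i ∧ (gen s i).1 m = m - 1 ∧ ((gen s i).1 m : ZMod s) = i - 1) ∨
    ((m : ZMod s) ≠ i - 1 ∧ (m : ZMod s) ≠ i ∧ (gen s i).1 m = m) := by
  simp only [show (gen s i).1 m = genFun s i m from rfl, genFun]
  split_ifs with h1 h2
  · exact Or.inl ⟨h1, rfl, by simp [h1]⟩
  · exact Or.inr (Or.inl ⟨h2, rfl, by simp [h2]⟩)
  · exact Or.inr (Or.inr ⟨h1, h2, rfl⟩)

theorem gen_mul_gen_comm (hi : i ≠ j - 1) (hj : j ≠ i - 1) :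
    gen s i * gen s j = gen s j * gen s i := by
  apply Subtype.ext
  ext m
  have := gen_apply_cases i m
  have := gen_apply_cases j m
  have := gen_apply_cases i ((gen s j).1 m)
  have := gen_apply_cases j ((gen s i).1 m)
  simp only [Subgroup.coe_mul, Equiv.Perm.mul_apply]
  grind

theorem gen_braid (h2 : (2 : ZMod s) ≠ 0) (h : j = i - 1) :
    gen s i * gen s j * gen s i = gen s j * gen s i * gen s j := by
  apply Subtype.ext
  ext m
  have : (1 : ZMod s) ≠ 0 := one_ne_zero
  have := gen_apply_cases i m
  have := gen_apply_cases j m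
  have := gen_apply_cases i ((gen s j).1 m)
  have := gen_apply_cases j ((gen s i).1 m)
  have := gen_apply_cases i ((gen s j).1 ((gen s i).1 m))
  have := gen_apply_cases j ((gen s i).1 ((gen s j).1 m))
  simp only [Subgroup.coe_mul, Equiv.Perm.mul_apply]
  grind

theorem eq_zero_or_eq_half_of_two_mul {n : ℕ} [NeZero n] {i : ZMod n}
    (h : 2 * i = 0 ∨ 2 * i = -1) : i = 0 ∨ i = ((n / 2 : ℕ) : ZMod n) := by
  have hlt := ZMod.val_lt i
  have hi : ((i.val : ℕ) : ZMod n) = i := ZMod.natCast_zmod_val i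
  have hdvd : n ∣ 2 * i.val ∨ n ∣ 2 * i.val + 1 := by
    simp only [← ZMod.natCast_eq_zero_iff]
    push_cast
    rw [hi]
    exact h.imp id fun h => by rw [h, neg_add_cancel]
  by_cases h0 : i.val = 0
  · exact Or.inl ((ZMod.val_eq_zero i).1 h0)
  · right
    have hhalf : n / 2 = i.val := by
      rcases hdvd with ⟨k, hk⟩ | ⟨k, hk⟩
      all_goals
        have hk2 : k < 2 := by by_contra hge; nlinarith
        interval_cases k <;> omega
    rw [hhalf, hi]

theorem two_mul_half_eq (n : ℕ) :
    2 * ((n / 2 : ℕ) : ZMod n) = 0 ∨ 2 * ((n / 2 : ℕ) : ZMod n) = -1 := by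
  have h : ((2 * (n / 2) + n % 2 : ℕ) : ZMod n) = 0 := by rw [Nat.div_add_mod, ZMod.natCast_self]
  push_cast at h
  rcases Nat.mod_two_eq_zero_or_one n with hn | hn <;> rw [hn] at h
  · left
    simpa using h
  · right
    push_cast at h
    linear_combination h

theorem hypGen_cases (i : ZMod s) :
    (-i = i ∧ hypGen s i = gen s i) ∨
    ((-i = i - 1 ∨ i = -i - 1) ∧ (2 : ZMod s) ≠ 0 ∧
      hypGen s i = gen s i * gen s (-i) * gen s i) ∨
    (i ≠ -i ∧ i ≠ -i - 1 ∧ -i ≠ i - 1 ∧ hypGen s i = gen s i * gen s (-i)) := by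
  have : (1 : ZMod s) ≠ 0 := one_ne_zero
  by_cases h0 : i = 0
  · exact Or.inl ⟨by rw [h0, neg_zero], by rw [hypGen, if_pos h0]⟩
  by_cases hu : i = ((s / 2 : ℕ) : ZMod s) ∨ i = -((s / 2 : ℕ) : ZMod s)
  · have hgen : hypGen s i = gen s i * gen s (-i) * gen s i := by
      rw [hypGen, if_neg h0, if_pos hu]
    by_cases hi : -i = i
    · exact Or.inl ⟨hi, by rw [hgen, hi, gen_mul_self, one_mul]⟩
    · have := two_mul_half_eq s
      exact Or.inr (Or.inl ⟨by grind, by grind, hgen⟩)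
  · have hi := eq_zero_or_eq_half_of_two_mul (i := i)
    have hi' := eq_zero_or_eq_half_of_two_mul (i := -i)
    exact Or.inr (Or.inr ⟨by grind, by grind, by grind, by rw [hypGen, if_neg h0, if_neg hu]⟩)

end Coxeter

section Runner

variable {s t : ℕ}

/-- The residue class of the beads on the `i`-th runner of the `s`-abacus. The runners are ordered
so that `w_i` interchanges the runners `i - 1` and `i` under the level `t` action. -/
def runner (s t : ℕ) (i : ZMod s) : ZMod s := i * t - shift s t

theorem runner_sub_one (i : ZMod s) : runner s t (i - 1) = runner s t i - t := by
  unfold runner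
  ring

theorem runner_bijective (hst : s.Coprime t) : Function.Bijective (runner s t) := by
  have h := inv_mul_self hst
  refine ⟨fun i j hij => ?_, fun x => ⟨(t : ZMod s)⁻¹ * (x + shift s t), ?_⟩⟩
  · unfold runner at hij
    linear_combination (t : ZMod s)⁻¹ * hij + (j - i) * h
  · unfold runner
    linear_combination (x + shift s t) * h

theorem two_mul_shift (hst : s.Coprime t) : 2 * shift s t = (s - 1) * (t - 1) := by
  refine Nat.mul_div_cancel' (even_iff_two_dvd.1 ?_)
  by_contra hodd
  rw [Nat.even_mul, not_or, Nat.not_even_iff, Nat.not_even_iff] at hodd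
  exact Nat.not_coprime_of_dvd_of_dvd one_lt_two (by omega) (by omega) hst

theorem pos_of_coprime [Fact (1 < s)] (hst : s.Coprime t) : 0 < t := by
  have hs : 1 < s := Fact.out
  refine Nat.pos_of_ne_zero fun ht => ?_
  rw [ht, Nat.coprime_zero_right] at hst
  omega

theorem runner_neg_one_sub [Fact (1 < s)] (hst : s.Coprime t) (i : ZMod s) :
    runner s t (-1 - i) = -1 - runner s t i := by
  have hs : 1 < s := Fact.out
  have h := congrArg (Nat.cast : ℕ → ZMod s) (two_mul_shift hst)
  push_cast [Nat.cast_pred (pos_of_coprime hst), Nat.cast_pred (zero_lt_one.trans hs),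
    ZMod.natCast_self] at h
  unfold runner
  linear_combination -h

end Runner

section Conjugation

variable {s t : ℕ} {lam : YoungDiagram}

theorem IsCore.levelPart [NeZero s] (hst : s.Coprime t) (hlam : IsCore s lam)
    (w : affineSymm s) : IsCore s (levelPart s t hst w lam) := by
  have hs : 0 < s := Nat.pos_of_neZero s
  rw [isCore_iff hs] at hlam ⊢
  rw [betaSet_levelPart]
  rintro _ ⟨m, hm, rfl⟩
  refine ⟨m - s, hlam m hm, ?_⟩
  rw [eq_sub_iff_add_eq, ← (levelInt_mem hst w).1, sub_add_cancel]

variable [Fact (1 < s)] (hst : s.Coprime t)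

theorem mem_betaSet_levelPart_gen {i : ZMod s} {m : ℤ} :
    m ∈ betaSet (levelPart s t hst (gen s i) lam) ↔
      levelInt s t hst (gen s i) m ∈ betaSet lam := by
  rw [betaSet_levelPart, (levelInt_gen_involutive hst i).image_eq_preimage_symm, Set.mem_preimage]

theorem levelInt_gen_cases (i : ZMod s) (m : ℤ) :
    ((m : ZMod s) = runner s t (i - 1) ∧ levelInt s t hst (gen s i) m = m + t) ∨
    ((m : ZMod s) = runner s t i ∧ levelInt s t hst (gen s i) m = m - t) ∨
    ((m : ZMod s) ≠ runner s t (i - 1) ∧ (m : ZMod s) ≠ runner s t i ∧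
      levelInt s t hst (gen s i) m = m) := by
  rw [levelInt_gen]
  split_ifs with h1 h2
  · exact Or.inl ⟨h1, rfl⟩
  · exact Or.inr (Or.inl ⟨h2, rfl⟩)
  · exact Or.inr (Or.inr ⟨h1, h2, rfl⟩)

theorem levelInt_gen_neg_one_sub (i : ZMod s) (m : ℤ) :
    levelInt s t hst (gen s i) (-1 - m) = -1 - levelInt s t hst (gen s (-i)) m := by
  have hne : runner s t (i - 1) ≠ runner s t i := fun h =>
    one_ne_zero (sub_eq_self.1 ((runner_bijective hst).1 h))
  have hr : runner s t (-i - 1) = -1 - runner s t i := by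
    rw [← runner_neg_one_sub hst]
    congr 1
    ring
  have hr' : runner s t (-i) = -1 - runner s t (i - 1) := by
    rw [← runner_neg_one_sub hst]
    congr 1
    ring
  have hcast : ((-1 - m : ℤ) : ZMod s) = -1 - m := by push_cast; rfl
  have h := levelInt_gen_cases hst i (-1 - m)
  have h' := levelInt_gen_cases hst (-i) m
  grind

theorem transpose_levelPart_gen (i : ZMod s) (lam : YoungDiagram) :
    (levelPart s t hst (gen s i) lam).transpose =
      levelPart s t hst (gen s (-i)) lam.transpose := by
  apply betaSet_injective
  ext m
  rw [mem_betaSet_transpose, mem_betaSet_levelPart_gen, mem_betaSet_levelPart_gen,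
    mem_betaSet_transpose, levelInt_gen_neg_one_sub]

theorem transpose_levelPart_hypGen (i : ZMod s) (lam : YoungDiagram) :
    (levelPart s t hst (hypGen s i) lam).transpose =
      levelPart s t hst (hypGen s i) lam.transpose := by
  rcases hypGen_cases i with ⟨hi, h⟩ | ⟨hi, h2, h⟩ | ⟨-, hi, hi', h⟩
  · rw [h, transpose_levelPart_gen, hi]
  · have hbraid : gen s (-i) * gen s i * gen s (-i) = gen s i * gen s (-i) * gen s i :=
      hi.elim (fun hi => (gen_braid h2 hi).symm) (gen_braid h2)
    rw [h]
    nth_rw 2 [← hbraid]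
    simp only [map_mul, Equiv.Perm.mul_apply, transpose_levelPart_gen, neg_neg]
  · rw [h]
    nth_rw 2 [gen_mul_gen_comm hi hi']
    simp only [map_mul, Equiv.Perm.mul_apply, transpose_levelPart_gen, neg_neg]

theorem transpose_levelPart {v : affineSymm s} (hv : v ∈ hyp s) (lam : YoungDiagram) :
    (levelPart s t hst v lam).transpose = levelPart s t hst v lam.transpose := by
  induction hv using Subgroup.closure_induction generalizing lam with
  | mem x hx =>
    obtain ⟨i, rfl⟩ := hx
    exact transpose_levelPart_hypGen hst i lam
  | one => simp only [map_one, Equiv.Perm.one_apply]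
  | mul x y _ _ hx hy => simp only [map_mul, Equiv.Perm.mul_apply, hx, hy]
  | inv x _ hx =>
    rw [map_inv, Equiv.Perm.eq_inv_iff_eq, ← hx, ← Equiv.Perm.mul_apply, mul_inv_cancel,
      Equiv.Perm.one_apply]

theorem levelPart_mem_scCores {v : affineSymm s} (hv : v ∈ hyp s) (hlam : lam ∈ scCores s) :
    levelPart s t hst v lam ∈ scCores s :=
  ⟨by rw [transpose_levelPart hst hv, hlam.1], hlam.2.levelPart hst v⟩

end Conjugation

section Ends

variable {s t : ℕ} {q : ZMod s → ℤ} {B : Set ℤ} {lam : YoungDiagram}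

/-- On the `s`-abacus of `B` every runner is a pile without gaps: `q i` is the least integer on the
runner `i` that is not in `B`. -/
structure IsEnds (s t : ℕ) (q : ZMod s → ℤ) (B : Set ℤ) : Prop where
  cast_eq (i : ZMod s) : (q i : ZMod s) = runner s t i
  mem_iff {i : ZMod s} {m : ℤ} (hm : (m : ZMod s) = runner s t i) : m ∈ B ↔ m < q i

theorem IsEnds.eq_of_notMem [NeZero s] (hq : IsEnds s t q B) {i : ZMod s} {m : ℤ}
    (hm : (m : ZMod s) = runner s t i) (hmB : m ∉ B) (hmsB : m - s ∈ B) : q i = m := by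
  rw [hq.mem_iff hm] at hmB
  rw [hq.mem_iff (i := i) (by simpa using hm)] at hmsB
  obtain ⟨k, hk⟩ := exists_mul_of_cast_eq (hm.trans (hq.cast_eq i).symm)
  have : (0 : ℤ) < s := by exact_mod_cast Nat.pos_of_neZero s
  have hk0 : 0 ≤ k := by by_contra hlt; nlinarith
  have hk1 : k < 1 := by by_contra hle; nlinarith
  obtain rfl : k = 0 := by omega
  rw [hk, mul_zero, add_zero]

theorem exists_isEnds [NeZero s] (h : IsCore s lam) : ∃ q, IsEnds s t q (betaSet lam) := by
  have hs := Nat.pos_of_neZero s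
  have hex (i : ZMod s) : ∃ z : ℤ, (z ∉ betaSet lam ∧ (z : ZMod s) = runner s t i) ∧
      ∀ z' : ℤ, z' ∉ betaSet lam ∧ (z' : ZMod s) = runner s t i → z ≤ z' := by
    refine Int.exists_least_of_bdd
      ⟨-lam.colLen 0, fun z hz => neg_colLen_le_of_notMem_betaSet lam hz.1⟩
      ⟨(runner s t i).val + s * lam.rowLen 0, fun hmem => ?_, by simp⟩
    have hlt := lt_rowLen_of_mem_betaSet lam hmem
    have hle := Nat.le_mul_of_pos_left (lam.rowLen 0) hs
    zify at hle
    omega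
  choose q hq hmin using hex
  refine ⟨q, fun i => (hq i).2, fun {i m} hm => ⟨fun hmB => ?_, fun hlt => ?_⟩⟩
  · refine lt_of_not_ge fun hle => (hq i).1 ?_
    obtain ⟨k, hk⟩ := exists_mul_of_cast_eq (hm.trans (hq i).2.symm)
    have hk0 : 0 ≤ k := by by_contra hlt; zify at hs; nlinarith
    lift k to ℕ using hk0
    rw [eq_sub_of_add_eq hk.symm]
    exact sub_mul_mem ((isCore_iff hs).1 h) hmB k
  · by_contra hmB
    exact absurd (hmin i m ⟨hmB, hm⟩) (not_le.2 hlt)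

/-- The action of `w_i` on the ends of the runners: it interchanges the runners `i - 1` and `i`,
moving them up and down by `t`. -/
def reflect (t : ℕ) (i : ZMod s) (q : ZMod s → ℤ) : ZMod s → ℤ :=
  fun j => if j = i - 1 then q i - t else if j = i then q (i - 1) + t else q j

theorem IsEnds.levelPart_gen [Fact (1 < s)] (hst : s.Coprime t) (hq : IsEnds s t q (betaSet lam))
    (i : ZMod s) :
    IsEnds s t (reflect t i q) (betaSet (levelPart s t hst (gen s i) lam)) where
  cast_eq j := by
    have hrunner := runner_sub_one (t := t) i
    unfold reflect
    split_ifs with h1 h2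
    · rw [h1, hrunner, ← hq.cast_eq i]
      push_cast
      rfl
    · rw [h2, eq_add_of_sub_eq hrunner.symm, ← hq.cast_eq (i - 1)]
      push_cast
      rfl
    · exact hq.cast_eq j
  mem_iff {j m} hm := by
    have hne : i ≠ i - 1 := Ne.symm (sub_eq_self.not.2 one_ne_zero)
    have hrunner := runner_sub_one (t := t) i
    have hinj := (runner_bijective hst).1
    rw [mem_betaSet_levelPart_gen, reflect]
    rcases levelInt_gen_cases hst i m with ⟨hmi, h⟩ | ⟨hmi, h⟩ | ⟨hmi, hmi', h⟩
    · rw [h, if_pos (hinj (hm.symm.trans hmi)),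
        hq.mem_iff (i := i) (by push_cast; rw [hmi, hrunner, sub_add_cancel]), lt_sub_iff_add_lt]
    · rw [h, hinj (hm.symm.trans hmi), if_neg hne, if_pos rfl,
        hq.mem_iff (i := i - 1) (by push_cast; rw [hmi, hrunner]), sub_lt_iff_lt_add]
    · rw [h, if_neg fun h => hmi (by rw [hm, h]),
        if_neg fun h => hmi' (by rw [hm, h]), hq.mem_iff hm]

theorem IsEnds.apply_neg_one_sub [Fact (1 < s)] (hst : s.Coprime t)
    (hq : IsEnds s t q (betaSet lam)) (hlam : lam.transpose = lam) (i : ZMod s) :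
    q (-1 - i) = s - 1 - q i := by
  have hsymm (m : ℤ) : m ∈ betaSet lam ↔ -1 - m ∉ betaSet lam := by
    rw [← mem_betaSet_transpose, hlam]
  have hcast := hq.cast_eq i
  apply hq.eq_of_notMem
  · push_cast
    rw [ZMod.natCast_self, zero_sub, runner_neg_one_sub hst, hcast]
  · rw [hsymm, not_not, show -1 - (s - 1 - q i) = q i - s by ring,
      hq.mem_iff (i := i) (by simpa using hcast)]
    have := Nat.pos_of_neZero s
    omega
  · rw [hsymm, show -1 - (s - 1 - q i - s) = q i by ring, hq.mem_iff hcast]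
    exact lt_irrefl _

/-- The excess of the runner `i` over the runner `i - 1`. A bead can be moved from the former to
the latter, which removes a rim hook of length `t`, if and only if the excess is positive. -/
def excess (t : ℕ) (q : ZMod s → ℤ) (i : ZMod s) : ℤ := q i - q (i - 1) - t

theorem IsEnds.excess_neg [Fact (1 < s)] (hst : s.Coprime t) (hq : IsEnds s t q (betaSet lam))
    (hlam : lam.transpose = lam) (i : ZMod s) : excess t q (-i) = excess t q i := by
  have h := hq.apply_neg_one_sub hst hlam i
  have h' := hq.apply_neg_one_sub hst hlam (i - 1)
  rw [show -1 - i = -i - 1 by ring] at h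
  rw [show -1 - (i - 1) = -i by ring] at h'
  unfold excess
  linarith

theorem IsEnds.exists_excess_pos (hst : s.Coprime t) (ht : 0 < t)
    (hq : IsEnds s t q (betaSet lam)) (hlam : ¬IsCore t lam) : ∃ i, 0 < excess t q i := by
  rw [isCore_iff ht] at hlam
  push Not at hlam
  obtain ⟨m, hm, hmt⟩ := hlam
  obtain ⟨i, hi⟩ := (runner_bijective hst).2 m
  rw [hq.mem_iff hi.symm] at hm
  rw [hq.mem_iff (i := i - 1) (by push_cast; rw [runner_sub_one, hi])] at hmt
  refine ⟨i, ?_⟩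
  unfold excess
  omega

theorem excess_reflect_of_not_adjacent {i j : ZMod s} (hij : i ≠ j) (hi : i ≠ j - 1)
    (hj : j ≠ i - 1) : excess t (reflect t i q) j = excess t q j := by
  simp only [excess, reflect]
  grind

theorem excess_reflect_of_adjacent {i j : ZMod s} (h2 : (2 : ZMod s) ≠ 0)
    (hij : j = i - 1 ∨ i = j - 1) : excess t (reflect t i q) j = excess t q j + excess t q i := by
  have h1 : (1 : ZMod s) ≠ 0 := fun h => h2 (by rw [← one_add_one_eq_two, h, add_zero])
  simp only [excess, reflect]
  grind

/-- The sum of the squares of the ends of the runners, which decreases in the descent to a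
`t`-core. -/
def energy [NeZero s] (q : ZMod s → ℤ) : ℤ := ∑ i, q i ^ 2

theorem energy_nonneg [NeZero s] (q : ZMod s → ℤ) : 0 ≤ energy q :=
  Finset.sum_nonneg fun _ _ => sq_nonneg _

variable [Fact (1 < s)] {i : ZMod s}

theorem excess_reflect_self (t : ℕ) (i : ZMod s) (q : ZMod s → ℤ) :
    excess t (reflect t i q) i = -excess t q i := by
  have hne : i ≠ i - 1 := Ne.symm (sub_eq_self.not.2 one_ne_zero)
  simp only [excess, reflect]
  grind

theorem energy_reflect (t : ℕ) (i : ZMod s) (q : ZMod s → ℤ) :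
    energy (reflect t i q) = energy q - 2 * t * excess t q i := by
  have hne : i ≠ i - 1 := Ne.symm (sub_eq_self.not.2 one_ne_zero)
  have hsq (j : ZMod s) : reflect t i q j ^ 2 = q j ^ 2 +
      (if j = i - 1 then (q i - t) ^ 2 - q (i - 1) ^ 2 else 0) +
      (if j = i then (q (i - 1) + t) ^ 2 - q i ^ 2 else 0) := by
    unfold reflect
    split_ifs <;> grind
  simp only [energy, excess, hsq, Finset.sum_add_distrib, Finset.sum_ite_eq', Finset.mem_univ,
    if_true]
  ring

theorem IsEnds.exists_hypGen (hst : s.Coprime t) (hq : IsEnds s t q (betaSet lam))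
    (hlam : lam.transpose = lam) (hi : 0 < excess t q i) :
    ∃ q', IsEnds s t q' (betaSet (levelPart s t hst (hypGen s i) lam)) ∧ energy q' < energy q := by
  have hpos : 0 < t * excess t q i := mul_pos (by exact_mod_cast pos_of_coprime hst) hi
  have hneg := hq.excess_neg hst hlam i
  rcases hypGen_cases i with ⟨-, hgen⟩ | ⟨hadj, h2, hgen⟩ | ⟨hne, hi, hi', hgen⟩
  · refine ⟨_, hgen ▸ hq.levelPart_gen hst i, ?_⟩
    rw [energy_reflect]
    linarith
  · have h : excess t (reflect t i q) (-i) = 2 * excess t q i := by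
      rw [excess_reflect_of_adjacent h2 hadj, hneg, two_mul]
    have h' : excess t (reflect t (-i) (reflect t i q)) i = excess t q i := by
      rw [excess_reflect_of_adjacent h2 hadj.symm, excess_reflect_self, h]
      ring
    refine ⟨reflect t i (reflect t (-i) (reflect t i q)), ?_, ?_⟩
    · rw [hgen, map_mul, map_mul]
      exact ((hq.levelPart_gen hst i).levelPart_gen hst (-i)).levelPart_gen hst i
    · rw [energy_reflect, energy_reflect, energy_reflect, h, h']
      linarith
  · refine ⟨reflect t i (reflect t (-i) q), ?_, ?_⟩
    · rw [hgen, map_mul]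
      exact (hq.levelPart_gen hst (-i)).levelPart_gen hst i
    · rw [energy_reflect, energy_reflect, excess_reflect_of_not_adjacent hne.symm hi' hi, hneg]
      linarith

end Ends

section Orbit

variable {s t : ℕ} [Fact (1 < s)] {hst : s.Coprime t} {lam mu nu : YoungDiagram}

theorem hypOrbit_trans (h : mu ∈ hypOrbit s t hst lam) (h' : nu ∈ hypOrbit s t hst mu) :
    nu ∈ hypOrbit s t hst lam := by
  obtain ⟨v, hv, rfl⟩ := h
  obtain ⟨w, hw, rfl⟩ := h'
  exact ⟨w * v, mul_mem hw hv, by rw [map_mul, Equiv.Perm.mul_apply]⟩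

theorem hypOrbit_symm (h : mu ∈ hypOrbit s t hst lam) : lam ∈ hypOrbit s t hst mu := by
  obtain ⟨v, hv, rfl⟩ := h
  exact ⟨v⁻¹, inv_mem hv, by
    rw [← Equiv.Perm.mul_apply, ← map_mul, inv_mul_cancel, map_one, Equiv.Perm.one_apply]⟩

theorem sameCharges_of_mem_hypOrbit (h : mu ∈ hypOrbit s t hst lam) :
    SameCharges t (betaSet lam) (betaSet mu) := by
  obtain ⟨v, hv, rfl⟩ := h
  exact sameCharges_levelPart hst (hyp_le_closure_gen hv) lam

theorem mem_scCores_of_mem_hypOrbit (hlam : lam ∈ scCores s) (h : mu ∈ hypOrbit s t hst lam) :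
    mu ∈ scCores s := by
  obtain ⟨v, hv, rfl⟩ := h
  exact levelPart_mem_scCores hst hv hlam

theorem exists_isCore_mem_hypOrbit (hst : s.Coprime t) (hlam : lam ∈ scCores s) :
    ∃ mu ∈ hypOrbit s t hst lam, IsCore t mu := by
  obtain ⟨q, hq⟩ := exists_isEnds (t := t) hlam.2
  induction hn : (energy q).toNat using Nat.strong_induction_on generalizing lam q with
  | _ n ih =>
    by_cases hcore : IsCore t lam
    · exact ⟨lam, ⟨1, one_mem _, by rw [map_one, Equiv.Perm.one_apply]⟩, hcore⟩
    obtain ⟨i, hi⟩ := hq.exists_excess_pos hst (pos_of_coprime hst) hcore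
    obtain ⟨q', hq', hlt⟩ := hq.exists_hypGen hst hlam.1 hi
    have hstep : levelPart s t hst (hypGen s i) lam ∈ hypOrbit s t hst lam :=
      ⟨_, Subgroup.subset_closure ⟨i, rfl⟩, rfl⟩
    have hnonneg := energy_nonneg q'
    obtain ⟨mu, hmu, hmucore⟩ :=
      ih _ (by omega) (mem_scCores_of_mem_hypOrbit hlam hstep) q' hq' rfl
    exact ⟨mu, hypOrbit_trans hstep hmu, hmucore⟩

theorem IsCoreOf.mem_hypOrbit (hst : s.Coprime t) (hlam : lam ∈ scCores s)
    (h : IsCoreOf t nu lam) : nu ∈ hypOrbit s t hst lam := by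
  obtain ⟨mu, hmu, hcore⟩ := exists_isCore_mem_hypOrbit hst hlam
  rwa [h.2.eq_of_sameCharges (pos_of_coprime hst) hcore
    (h.sameCharges.symm.trans (sameCharges_of_mem_hypOrbit hmu))]

end Orbit

end SCCore

theorem mainTheorem7 (s t : ℕ) [Fact (1 < s)] (hst : s.Coprime t) :
    (∀ v ∈ SCCore.hyp s, ∀ lam ∈ SCCore.scCores s,
      SCCore.levelPart s t hst v lam ∈ SCCore.scCores s) ∧
    (∀ lam ∈ SCCore.scCores s, ∃! nu, SCCore.IsCoreOf t nu lam) ∧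
    (∀ lam ∈ SCCore.scCores s, ∀ mu ∈ SCCore.scCores s,
      (∃ nu, SCCore.IsCoreOf t nu lam ∧ SCCore.IsCoreOf t nu mu) ↔
        mu ∈ SCCore.hypOrbit s t hst lam) ∧
    (∀ lam ∈ SCCore.scCores s, ∀ nu, SCCore.IsCoreOf t nu lam →
      nu ∈ SCCore.scCores s ∧ nu ∈ SCCore.hypOrbit s t hst lam) := by
  have ht := SCCore.pos_of_coprime hst
  refine ⟨fun v hv lam hlam => SCCore.levelPart_mem_scCores hst hv hlam,
    fun lam _ => SCCore.existsUnique_isCoreOf ht lam, fun lam hlam mu hmu => ⟨?_, fun h => ?_⟩,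
    fun lam hlam nu hnu => ?_⟩
  · rintro ⟨nu, hlamnu, hmunu⟩
    exact SCCore.hypOrbit_trans (hlamnu.mem_hypOrbit hst hlam)
      (SCCore.hypOrbit_symm (hmunu.mem_hypOrbit hst hmu))
  · obtain ⟨nu, hmunu⟩ := SCCore.exists_isCoreOf ht mu
    refine ⟨nu, (SCCore.isCoreOf_iff ht).2 ⟨hmunu.2, ?_⟩, hmunu⟩
    exact (SCCore.sameCharges_of_mem_hypOrbit h).trans hmunu.sameCharges
  · have horbit := hnu.mem_hypOrbit hst hlam
    exact ⟨SCCore.mem_scCores_of_mem_hypOrbit hlam horbit, horbit⟩
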